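/- **Theorem (Co-area Formula for measured manifolds of the same dimension).** A *volume element* on a smooth $n$-dimensional manifold $M$ (possibly with boundary and corners) is $d\mu_M=|\omega|$, where $\omega$ is a smooth nowhere vanishing $n$-form; it is enough that $\omega$ is defined locally, up to sign, so $M$ need not be orientable. In local coordinates $d\mu_M=|f|\,|dx_1\wedge\dots\wedge dx_n|$ with $f$ smooth and nowhere zero, and $d\mu_M$ determines the Borel measure $\mu_M$ on $M$ which is given by $|f|\,dx_1\cdots dx_n$ in each coordinate domain. A *measured manifold* is a smooth manifold (Hausdorff and second countable) with a chosen volume element. If $F:M\to N$ is a smooth map between measured manifolds of the same dimension $n$, the *generalized Jacobian* $|\mathrm{Jac}(F)|:M\to[0,\infty)$ is the unique function with $F^*(d\mu_N)=|\mathrm{Jac}(F)|\,d\mu_M$, that is, $d\mu_N(DF_p v_1,\dots,DF_p v_n)=|\mathrm{Jac}(F)|(p)\,d\mu_M(v_1,\dots,v_n)$ for all $p\in M$ and $v_1,\dots,v_n\in T_pM$. Let $M$ and $N$ be measured manifolds of the same dimension, with $M$ compact, and let $F:M\to N$ be a smooth map. For $p\in N$ let $\#(F^{-1}(p))\in\{0,1,2,\dots,\infty\}$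 be the number of points of $F^{-1}(p)$. Then $p\mapsto\#(F^{-1}(p))$ is Borel measurable on $N$, $|\mathrm{Jac}(F)|$ is integrable on $M$, and $$\int_N \#(F^{-1}(p))\,d\mu_N(p)=\int_M|\mathrm{Jac}(F)|\,d\mu_M .$$ In particular, both sides are finite. -/

import Mathlib

open scoped ContDiff Manifold
open MeasureTheory

namespace MeasuredManifold

/-- A (not necessarily smooth) differential form of top degree `n` on an `n`-dimensional manifold
`M`, possibly with boundary and corners. -/
abbrev TopForm {n : ℕ} {H : Type*} [TopologicalSpace H]
    (I : ModelWithCorners ℝ (EuclideanSpace ℝ (Fin n)) H)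
    (M : Type*) [TopologicalSpace M] [ChartedSpace H M] : Type _ :=
  ∀ p : M, (TangentSpace I p) [⋀^Fin n]→ₗ[ℝ] ℝ

/-- The standard basis of the tangent space at `p`, which in Mathlib is a copy of `ℝⁿ` (read through
the preferred chart at `p`). -/
noncomputable def stdFrame {n : ℕ} {H : Type*} [TopologicalSpace H]
    (I : ModelWithCorners ℝ (EuclideanSpace ℝ (Fin n)) H)
    {M : Type*} [TopologicalSpace M] [ChartedSpace H M] (p : M) : Fin n → TangentSpace I p :=
  fun i => (EuclideanSpace.single i (1 : ℝ) : EuclideanSpace ℝ (Fin n))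

/-- The coordinate frame `∂/∂x₁, …, ∂/∂xₙ` of the chart at `x`, at the point with coordinates `y`:
the images of the standard basis vectors under the derivative of the inverse chart. -/
noncomputable def coordFrame {n : ℕ} {H : Type*} [TopologicalSpace H]
    (I : ModelWithCorners ℝ (EuclideanSpace ℝ (Fin n)) H)
    {M : Type*} [TopologicalSpace M] [ChartedSpace H M] (x : M) (y : EuclideanSpace ℝ (Fin n)) :
    Fin n → TangentSpace I ((extChartAt I x).symm y) :=
  fun i => mfderivWithin 𝓘(ℝ, EuclideanSpace ℝ (Fin n)) I (extChartAt I x).symm (Set.range I) y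
    (EuclideanSpace.single i (1 : ℝ) : EuclideanSpace ℝ (Fin n))

/-- The form `η` is smooth on `U`: in every chart `η = f dx₁ ∧ … ∧ dxₙ` with `f` smooth on the part
of the coordinate domain that corresponds to `U`. -/
def TopForm.SmoothOn {n : ℕ} {H : Type*} [TopologicalSpace H]
    {I : ModelWithCorners ℝ (EuclideanSpace ℝ (Fin n)) H}
    {M : Type*} [TopologicalSpace M] [ChartedSpace H M] (η : TopForm I M) (U : Set M) : Prop :=
  ∀ x : M, ContDiffOn ℝ ∞ (fun y => η ((extChartAt I x).symm y) (coordFrame I x y))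
    ((extChartAt I x).target ∩ (extChartAt I x).symm ⁻¹' U)

/-- A volume element on `M`: the absolute value `|η|` of a smooth nowhere vanishing `n`-form. The
form is only required to exist near each point (up to sign), so that non-orientable manifolds, for
example with their Riemannian volume elements, are included. -/
structure VolumeElement {n : ℕ} {H : Type*} [TopologicalSpace H]
    (I : ModelWithCorners ℝ (EuclideanSpace ℝ (Fin n)) H)
    (M : Type*) [TopologicalSpace M] [ChartedSpace H M] where
  /-- The value on `n` tangent vectors at a point. -/
  toFun : ∀ p : M, (Fin n → TangentSpace I p) → ℝ
  eq_abs_form : ∀ p : M, ∃ U : Set M, IsOpen U ∧ p ∈ U ∧ ∃ η : TopForm I M, η.SmoothOn U ∧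
    (∀ q ∈ U, η q ≠ 0) ∧ ∀ q ∈ U, ∀ v : Fin n → TangentSpace I q, toFun q v = |η q v|

namespace VolumeElement

/-- The measure `|f| dx₁ ⋯ dxₙ` on the domain of the chart at `x`, as a measure on `M` that vanishes
outside this domain; here `|f| |dx₁ ∧ … ∧ dxₙ|` is the volume element in the chart. -/
noncomputable def chartMeasure {n : ℕ} {H : Type*} [TopologicalSpace H]
    {I : ModelWithCorners ℝ (EuclideanSpace ℝ (Fin n)) H}
    {M : Type*} [TopologicalSpace M] [ChartedSpace H M] [MeasurableSpace M]
    (μ : VolumeElement I M) (x : M) : Measure M :=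
  (((volume : Measure (EuclideanSpace ℝ (Fin n))).restrict (extChartAt I x).target).withDensity
    (fun y => ENNReal.ofReal (μ.toFun ((extChartAt I x).symm y) (coordFrame I x y)))).map
    (extChartAt I x).symm

/-- `chartMeasure` in coordinates: `∫ |f| dx₁ ⋯ dxₙ` over the part of the coordinate domain that
corresponds to `A`. -/
theorem chartMeasure_apply {n : ℕ} {H : Type*} [TopologicalSpace H]
    {I : ModelWithCorners ℝ (EuclideanSpace ℝ (Fin n)) H}
    {M : Type*} [TopologicalSpace M] [ChartedSpace H M] [MeasurableSpace M] [BorelSpace M]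
    (μ : VolumeElement I M) (x : M) (A : Set M) (hA : MeasurableSet A) :
    μ.chartMeasure x A = ∫⁻ y in (extChartAt I x).target ∩ (extChartAt I x).symm ⁻¹' A,
      ENNReal.ofReal (μ.toFun ((extChartAt I x).symm y) (coordFrame I x y)) := by
  have ht : MeasurableSet (extChartAt I x).target := by
    rw [extChartAt_target]
    exact ((chartAt H x).open_target.preimage I.continuous_symm).measurableSet.inter
      I.isClosed_range.measurableSet
  have hm : AEMeasurable (extChartAt I x).symm
      ((volume : Measure (EuclideanSpace ℝ (Fin n))).restrict (extChartAt I x).target) :=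
    (continuousOn_extChartAt_symm x).aemeasurable ht
  have hac := hm.mono_ac (withDensity_absolutelyContinuous _ (fun y =>
    ENNReal.ofReal (μ.toFun ((extChartAt I x).symm y) (coordFrame I x y))))
  rw [VolumeElement.chartMeasure, Measure.map_apply_of_aemeasurable hac hA]
  rw [withDensity_apply₀, Measure.restrict_restrict₀, Set.inter_comm]
  · exact hm.nullMeasurable hA
  · exact hm.nullMeasurable hA

/-- The Borel measure determined by a volume element. By the change of variable formula, the
measures of any two charts agree on the overlap of their domains; the least upper bound of all of
them is the measure on `M` that agrees with each of them on the domain of the chart. -/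
noncomputable def measure {n : ℕ} {H : Type*} [TopologicalSpace H]
    {I : ModelWithCorners ℝ (EuclideanSpace ℝ (Fin n)) H}
    {M : Type*} [TopologicalSpace M] [ChartedSpace H M] [MeasurableSpace M]
    (μ : VolumeElement I M) : Measure M :=
  ⨆ x : M, μ.chartMeasure x

/-- The pull-back of a volume element under `F`, evaluated on `n` tangent vectors at `p`. -/
noncomputable def pullback {n : ℕ} {H H' : Type*} [TopologicalSpace H] [TopologicalSpace H']
    {I : ModelWithCorners ℝ (EuclideanSpace ℝ (Fin n)) H}
    {J : ModelWithCorners ℝ (EuclideanSpace ℝ (Fin n)) H'}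
    {M N : Type*} [TopologicalSpace M] [ChartedSpace H M] [TopologicalSpace N] [ChartedSpace H' N]
    (ν : VolumeElement J N) (F : M → N) (p : M) (v : Fin n → TangentSpace I p) : ℝ :=
  ν.toFun (F p) (fun i => mfderiv I J F p (v i))

end VolumeElement

/-- The generalized Jacobian `|Jac F|` of a map between measured manifolds of the same dimension:
the function `α` with `F^* dμ_N = α dμ_M`. It is computed on one frame; that this gives the equality
on all tangent vectors, and the uniqueness of `α`, are proved below. -/
noncomputable def absJac {n : ℕ} {H H' : Type*} [TopologicalSpace H] [TopologicalSpace H']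
    {I : ModelWithCorners ℝ (EuclideanSpace ℝ (Fin n)) H}
    {J : ModelWithCorners ℝ (EuclideanSpace ℝ (Fin n)) H'}
    {M N : Type*} [TopologicalSpace M] [ChartedSpace H M] [TopologicalSpace N] [ChartedSpace H' N]
    (μ : VolumeElement I M) (ν : VolumeElement J N) (F : M → N) (p : M) : ℝ :=
  ν.pullback (I := I) F p (stdFrame I p) / μ.toFun p (stdFrame I p)

theorem alternating_eq_smul_det {n : ℕ}
    (w : (EuclideanSpace ℝ (Fin n)) [⋀^Fin n]→ₗ[ℝ] ℝ) (v : Fin n → EuclideanSpace ℝ (Fin n)) :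
    w v = w (fun i => EuclideanSpace.single i (1 : ℝ)) *
      (EuclideanSpace.basisFun (Fin n) ℝ).toBasis.det v := by
  have h := w.eq_smul_basis_det (EuclideanSpace.basisFun (Fin n) ℝ).toBasis
  have h' := congrArg (fun u => u v) h
  have e : (fun i => EuclideanSpace.single i (1 : ℝ)) =
      ⇑(EuclideanSpace.basisFun (Fin n) ℝ).toBasis := by
    ext i; simp
  rw [e]
  simpa using h'

theorem VolumeElement.stdFrame_pos {n : ℕ} {H : Type*} [TopologicalSpace H]
    {I : ModelWithCorners ℝ (EuclideanSpace ℝ (Fin n)) H}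
    {M : Type*} [TopologicalSpace M] [ChartedSpace H M] (μ : VolumeElement I M) (p : M) :
    0 < μ.toFun p (stdFrame I p) := by
  obtain ⟨U, -, hp, η, -, h0, h⟩ := μ.eq_abs_form p
  rw [h p hp, abs_pos]
  intro hz
  apply h0 p hp
  ext v
  have := alternating_eq_smul_det (n := n) (η p) v
  refine this.trans ?_
  have hz' : (η p) (fun i => (EuclideanSpace.single i (1 : ℝ) : EuclideanSpace ℝ (Fin n))) = 0 := hz
  exact (congrArg (· * _) hz').trans (zero_mul _)

theorem absJac_nonneg {n : ℕ} {H H' : Type*} [TopologicalSpace H] [TopologicalSpace H']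
    {I : ModelWithCorners ℝ (EuclideanSpace ℝ (Fin n)) H}
    {J : ModelWithCorners ℝ (EuclideanSpace ℝ (Fin n)) H'}
    {M N : Type*} [TopologicalSpace M] [ChartedSpace H M] [TopologicalSpace N] [ChartedSpace H' N]
    (μ : VolumeElement I M) (ν : VolumeElement J N) (F : M → N) (p : M) :
    0 ≤ absJac μ ν F p := by
  refine div_nonneg ?_ (μ.stdFrame_pos p).le
  obtain ⟨U, -, hp, η, -, -, h⟩ := ν.eq_abs_form (F p)
  rw [VolumeElement.pullback, h _ hp]
  exact abs_nonneg _

/-- `F^* dμ_N = |Jac F| dμ_M`. -/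
theorem pullback_eq_absJac_mul {n : ℕ} {H H' : Type*} [TopologicalSpace H] [TopologicalSpace H']
    {I : ModelWithCorners ℝ (EuclideanSpace ℝ (Fin n)) H}
    {J : ModelWithCorners ℝ (EuclideanSpace ℝ (Fin n)) H'}
    {M N : Type*} [TopologicalSpace M] [ChartedSpace H M] [TopologicalSpace N] [ChartedSpace H' N]
    (μ : VolumeElement I M) (ν : VolumeElement J N) (F : M → N) (p : M)
    (v : Fin n → TangentSpace I p) :
    ν.pullback F p v = absJac μ ν F p * μ.toFun p v := by
  have hpos := μ.stdFrame_pos p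
  obtain ⟨U, -, hp, η, -, -, h⟩ := μ.eq_abs_form p
  obtain ⟨V, -, hq, κ, -, -, k⟩ := ν.eq_abs_form (F p)
  rw [absJac, VolumeElement.pullback, VolumeElement.pullback]
  rw [h p hp] at hpos
  rw [h p hp, h p hp, k _ hq, k _ hq, div_mul_eq_mul_div, eq_div_iff hpos.ne']
  have a1 : η p v = η p (stdFrame I p) * _ := alternating_eq_smul_det (n := n) (η p) v
  have a2 : κ (F p) (fun i => mfderiv I J F p (v i)) =
      κ (F p) (fun i => mfderiv I J F p (stdFrame I p i)) * _ :=
    alternating_eq_smul_det (n := n)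
      ((κ (F p)).compLinearMap (mfderiv I J F p).toLinearMap) v
  rw [a1, a2, abs_mul, abs_mul]
  ring

/-- `|Jac F|(p)` is the only number `a` with `F^* dμ_N = a dμ_M` at `p`. -/
theorem eq_absJac {n : ℕ} {H H' : Type*} [TopologicalSpace H] [TopologicalSpace H']
    {I : ModelWithCorners ℝ (EuclideanSpace ℝ (Fin n)) H}
    {J : ModelWithCorners ℝ (EuclideanSpace ℝ (Fin n)) H'}
    {M N : Type*} [TopologicalSpace M] [ChartedSpace H M] [TopologicalSpace N] [ChartedSpace H' N]
    (μ : VolumeElement I M) (ν : VolumeElement J N) (F : M → N) (p : M) (a : ℝ)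
    (ha : ∀ v : Fin n → TangentSpace I p, ν.pullback F p v = a * μ.toFun p v) :
    a = absJac μ ν F p := by
  rw [absJac, ha, mul_div_cancel_right₀ _ (μ.stdFrame_pos p).ne']

end MeasuredManifold

/-! Both sides are countably additive over disjoint measurable pieces `A` of `M`, if the
multiplicity is counted on `A` and the Jacobian is integrated over `A` (`AreaFormulaOn.iUnion`). So
it suffices to cut `M` into countably many pieces on which the formula is clear. Each piece lies in
one chart and is mapped by `F` into one chart of `N`. There the chain rule turns the generalized
Jacobian into an ordinary determinant weighted by the two densities (`density_localRep_mul`).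

Where the Jacobian vanishes, the equidimensional Sard lemma makes the image null, and both sides are
zero. Elsewhere the piece is cut further until `F` is injective: a map close enough to an invertible
linear map is injective. For injective `F` the multiplicity is the indicator of the image, and the
formula is the Euclidean change of variables. All derivatives are taken within sets, so boundary and
corners need no separate treatment.

Three facts complete the proof. The supremum of the chart measures restricts to each of them, since
the case `F = id` shows that they agree on overlaps. The multiplicity is Borel, as a countable
supremum of finite sums of indicators of compact sets. Finally, the Jacobian is continuous and the
volume measure locally finite, so compactness of `M` gives integrability. -/

namespace MeasuredManifold
open Set Filter Topology

/-! ### Densities and Jacobians in charts -/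

section Local

variable {n : ℕ} {H H' : Type*} [TopologicalSpace H] [TopologicalSpace H']
  {I : ModelWithCorners ℝ (EuclideanSpace ℝ (Fin n)) H}
  {J : ModelWithCorners ℝ (EuclideanSpace ℝ (Fin n)) H'}
  {M N : Type*} [TopologicalSpace M] [ChartedSpace H M] [TopologicalSpace N] [ChartedSpace H' N]

/-- The coefficient of a volume element in the chart at `x`. -/
noncomputable def VolumeElement.density (μ : VolumeElement I M) (x : M)
    (y : EuclideanSpace ℝ (Fin n)) : ℝ :=
  μ.toFun ((extChartAt I x).symm y) (coordFrame I x y)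

/-- Top-degree alternating forms are multiples of the determinant, so a linear map scales them by
its own determinant. -/
theorem VolumeElement.toFun_map (μ : VolumeElement I M) (p : M)
    (L : EuclideanSpace ℝ (Fin n) →L[ℝ] EuclideanSpace ℝ (Fin n))
    (v : Fin n → EuclideanSpace ℝ (Fin n)) :
    μ.toFun p (fun i => (L (v i) : EuclideanSpace ℝ (Fin n))) = |L.det| * μ.toFun p v := by
  obtain ⟨U, -, hp, η, -, -, h⟩ := μ.eq_abs_form p
  have a1 : η p v = _ := alternating_eq_smul_det (n := n) (η p) v
  have a2 : η p (fun i => (L (v i) : EuclideanSpace ℝ (Fin n))) = _ :=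
    alternating_eq_smul_det (n := n) (η p) (fun i => L (v i))
  have a3 := (EuclideanSpace.basisFun (Fin n) ℝ).toBasis.det_comp
    (L : EuclideanSpace ℝ (Fin n) →ₗ[ℝ] EuclideanSpace ℝ (Fin n)) v
  have a4 : (EuclideanSpace.basisFun (Fin n) ℝ).toBasis.det (fun i => L (v i)) =
    L.det * (EuclideanSpace.basisFun (Fin n) ℝ).toBasis.det v := a3
  have b1 : μ.toFun p v = |η p v| := h p hp _
  have b2 : μ.toFun p (fun i => (L (v i) : EuclideanSpace ℝ (Fin n))) = |_| := h p hp _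
  rw [b1]
  refine b2.trans ?_
  rw [← abs_mul]
  congr 1
  refine a2.trans ?_
  rw [a4, a1]
  ring

theorem absJac_id (μ : VolumeElement I M) (p : M) : absJac μ μ id p = 1 := by
  symm
  apply eq_absJac
  intro v
  rw [one_mul, VolumeElement.pullback, mfderiv_id]
  rfl

theorem measurableSet_extChartAt_target (x : M) : MeasurableSet (extChartAt I x).target := by
  rw [extChartAt_target]
  exact ((chartAt H x).open_target.preimage I.continuous_symm).measurableSet.inter
    I.isClosed_range.measurableSet

theorem VolumeElement.continuousOn_density (μ : VolumeElement I M) (x : M) :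
    ContinuousOn (μ.density x) (extChartAt I x).target := by
  intro y hy
  -- The form depends on the point and is determined only up to sign; continuity survives because
  -- only its absolute value enters.
  obtain ⟨U, hU, hp, η, hs, -, h⟩ := μ.eq_abs_form ((extChartAt I x).symm y)
  have hc := ((hs x).continuousOn.abs) y ⟨hy, hp⟩
  have hT : (extChartAt I x).target ∩ (extChartAt I x).symm ⁻¹' U ∈
      𝓝[(extChartAt I x).target] y :=
    inter_mem self_mem_nhdsWithin
      (continuousOn_extChartAt_symm x y hy (hU.mem_nhds hp))
  refine (hc.congr (fun z hz => h _ hz.2 _) (h _ hp _)).mono_of_mem_nhdsWithin hT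

theorem VolumeElement.density_pos [IsManifold I 1 M] (μ : VolumeElement I M) (x : M)
    {y : EuclideanSpace ℝ (Fin n)} (hy : y ∈ (extChartAt I x).target) : 0 < μ.density x y := by
  set L : EuclideanSpace ℝ (Fin n) →L[ℝ] EuclideanSpace ℝ (Fin n) :=
    mfderivWithin 𝓘(ℝ, EuclideanSpace ℝ (Fin n)) I (extChartAt I x).symm (Set.range I) y with hL
  have h1 : μ.density x y = |L.det| * μ.toFun ((extChartAt I x).symm y) (stdFrame I _) :=
    μ.toFun_map _ L _
  obtain ⟨e, he⟩ : ∃ e : EuclideanSpace ℝ (Fin n) ≃L[ℝ] EuclideanSpace ℝ (Fin n), ↑e = L :=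
    isInvertible_mfderivWithin_extChartAt_symm hy
  rw [h1]
  refine mul_pos (abs_pos.2 ?_) (μ.stdFrame_pos _)
  rw [← he]
  exact (LinearEquiv.isUnit_det' e.toLinearEquiv).ne_zero

variable (I J) in
/-- The map `F` in the charts at `x` and `x'`. -/
noncomputable def localRep (F : M → N) (x : M) (x' : N) :
    EuclideanSpace ℝ (Fin n) → EuclideanSpace ℝ (Fin n) :=
  extChartAt J x' ∘ F ∘ (extChartAt I x).symm

variable (I J) in
/-- The natural domain of `localRep`. -/
def localDomain (F : M → N) (x : M) (x' : N) : Set (EuclideanSpace ℝ (Fin n)) :=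
  (extChartAt I x).target ∩ (extChartAt I x).symm ⁻¹' (F ⁻¹' (extChartAt J x').source)

theorem localDomain_mem_nhdsWithin {F : M → N} (hF : Continuous F) (x : M) (x' : N)
    {y : EuclideanSpace ℝ (Fin n)} (hy : y ∈ localDomain I J F x x') :
    localDomain I J F x x' ∈ 𝓝[range I] y := by
  have h := extChartAt_target_mem_nhdsWithin_of_mem hy.1
  refine inter_mem h ?_
  have := (continuousOn_extChartAt_symm x y hy.1).mono_of_mem_nhdsWithin h
  exact this (((isOpen_extChartAt_source x').preimage hF).mem_nhds hy.2)

/-- The domain is not open at boundary points, but it is a neighbourhood within `range I`, where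
derivatives are unique. -/
theorem uniqueDiffOn_localDomain {F : M → N} (hF : Continuous F) (x : M) (x' : N) :
    UniqueDiffOn ℝ (localDomain I J F x x') := fun y hy =>
  (I.uniqueDiffOn y (extChartAt_target_subset_range x hy.1)).mono_nhds
    (nhdsWithin_le_iff.2 (localDomain_mem_nhdsWithin hF x x' hy))

theorem chart_image_localRep (F : M → N) (x : M) (x' : N) {A : Set M}
    (hA : A ⊆ (extChartAt I x).source) :
    extChartAt J x' '' (F '' A) =
      localRep I J F x x' '' ((extChartAt I x).target ∩ (extChartAt I x).symm ⁻¹' A) := by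
  ext z
  constructor
  · rintro ⟨_, ⟨p, hp, rfl⟩, rfl⟩
    have e := (extChartAt I x).left_inv (hA hp)
    refine ⟨extChartAt I x p, ⟨(extChartAt I x).map_source (hA hp), ?_⟩, ?_⟩
    · rwa [mem_preimage, e]
    · simp only [localRep, Function.comp_apply, e]
  · rintro ⟨y, hy, rfl⟩
    exact ⟨_, ⟨_, hy.2, rfl⟩, rfl⟩

theorem target_inter_preimage_eq_image (x' : N) {B : Set N} (hB : B ⊆ (extChartAt J x').source) :
    (extChartAt J x').target ∩ (extChartAt J x').symm ⁻¹' B = extChartAt J x' '' B :=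
  ((extChartAt J x').image_eq_target_inter_inv_preimage hB).symm

theorem eq_source_inter_preimage_image (x' : N) {B : Set N}
    (hB : B ⊆ (extChartAt J x').source) :
    B = (extChartAt J x').source ∩ extChartAt J x' ⁻¹' (extChartAt J x' '' B) := by
  ext q
  constructor
  · exact fun h => ⟨hB h, mem_image_of_mem _ h⟩
  · rintro ⟨hq, r, hr, e⟩
    rwa [← (extChartAt J x').injOn (hB hr) hq e]

theorem injOn_localRep {F : M → N} (x : M) (x' : N) {A : Set M}
    (hA' : MapsTo F A (extChartAt J x').source) (hinj : InjOn F A) :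
    InjOn (localRep I J F x x') ((extChartAt I x).target ∩ (extChartAt I x).symm ⁻¹' A) := by
  intro y hy z hz h
  have h1 := (extChartAt J x').injOn (hA' hy.2) (hA' hz.2) h
  exact (extChartAt I x).symm.injOn hy.1 hz.1 (hinj hy.2 hz.2 h1)

variable [IsManifold I ∞ M] [IsManifold J ∞ N]

theorem contDiffOn_localRep {F : M → N} (hF : ContMDiff I J ∞ F) (x : M) (x' : N) :
    ContDiffOn ℝ ∞ (localRep I J F x x') (localDomain I J F x x') :=
  (contMDiff_iff.1 hF).2 x x'

/-- The pull-back identity evaluated on the coordinate frame: it links the intrinsic Jacobian to the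
determinant in Euclidean change of variables. -/
theorem density_localRep_mul {F : M → N} (hF : ContMDiff I J ∞ F) (μ : VolumeElement I M)
    (ν : VolumeElement J N) (x : M) (x' : N) {y : EuclideanSpace ℝ (Fin n)}
    (hy : y ∈ localDomain I J F x x') :
    |(fderivWithin ℝ (localRep I J F x x') (localDomain I J F x x') y).det| *
      ν.density x' (localRep I J F x x' y) =
      absJac μ ν F ((extChartAt I x).symm y) * μ.density x y := by
  have hM : IsManifold I 1 M := IsManifold.of_le (n := ∞) (by simp)
  have hN : IsManifold J 1 N := IsManifold.of_le (n := ∞) (by simp)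
  have hyr : y ∈ range I := extChartAt_target_subset_range x hy.1
  have hT := localDomain_mem_nhdsWithin hF.continuous x x' hy
  have hz : localRep I J F x x' y ∈ (extChartAt J x').target := (extChartAt J x').map_source hy.2
  have hu := I.uniqueDiffOn y hyr
  have hd : DifferentiableWithinAt ℝ (localRep I J F x x') (range I) y :=
    ((contDiffOn_localRep hF x x').differentiableOn (by simp) y hy).mono_of_mem_nhdsWithin hT
  have hD : fderivWithin ℝ (localRep I J F x x') (localDomain I J F x x') y =
      fderivWithin ℝ (localRep I J F x x') (range I) y :=
    ((hd.hasFDerivWithinAt.mono fun _ hw => extChartAt_target_subset_range x hw.1).fderivWithin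
      (uniqueDiffOn_localDomain hF.continuous x x' y hy))
  have hinv : (extChartAt J x').symm (localRep I J F x x' y) = F ((extChartAt I x).symm y) :=
    (extChartAt J x').left_inv hy.2
  -- The map from coordinates on `M` to `N` is differentiated twice, through `F` and through
  -- `localRep`; uniqueness of the derivative equates the two results.
  have e1 := (hF.mdifferentiable (by simp) ((extChartAt I x).symm y)).hasMFDerivAt
    |>.comp_hasMFDerivWithinAt y
    (mdifferentiableWithinAt_extChartAt_symm hy.1).hasMFDerivWithinAt
  have e2 := (mdifferentiableWithinAt_extChartAt_symm hz).hasMFDerivWithinAt.comp y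
    hd.hasFDerivWithinAt.hasMFDerivWithinAt
    (fun w _ => mem_range_self _)
  have e3 := e2.congr_of_eventuallyEq (f₁ := F ∘ (extChartAt I x).symm)
    (Filter.mem_of_superset hT fun w hw => ((extChartAt J x').left_inv hw.2).symm) hinv.symm
  have huM : UniqueMDiffWithinAt 𝓘(ℝ, EuclideanSpace ℝ (Fin n)) (range I) y :=
    uniqueMDiffWithinAt_iff_uniqueDiffWithinAt.2 hu
  have e4 := huM.eq e1 e3
  rw [VolumeElement.density, VolumeElement.density, ← pullback_eq_absJac_mul, hD]
  -- The two base points in `N` are equal but not definitionally so; with both generalized, the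
  -- equality can be substituted.
  have key : ∀ (q q' : N) (_ : q' = q)
      (A B D : EuclideanSpace ℝ (Fin n) →L[ℝ] EuclideanSpace ℝ (Fin n)) (_ : A = B.comp D),
      |D.det| * ν.toFun q' (fun i => B (EuclideanSpace.single i (1 : ℝ))) =
        ν.toFun q (fun i => A (EuclideanSpace.single i (1 : ℝ))) := by
    rintro _ q rfl _ B D rfl
    have c1 := ν.toFun_map q B (fun i => EuclideanSpace.single i (1 : ℝ))
    have c2 := ν.toFun_map q (B.comp D) (fun i => EuclideanSpace.single i (1 : ℝ))
    refine Eq.trans (congrArg _ c1) (Eq.trans ?_ c2.symm)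
    have c3 : (B.comp D).det = B.det * D.det := LinearMap.det_comp _ _
    rw [c3, abs_mul]
    ring
  exact key _ _ hinv _ _ _ e4

/-- Near a point the Jacobian is a quotient of continuous chart expressions with positive
denominator. -/
theorem continuous_absJac {F : M → N} (hF : ContMDiff I J ∞ F) (μ : VolumeElement I M)
    (ν : VolumeElement J N) : Continuous (absJac μ ν F) := by
  have hM : IsManifold I 1 M := IsManifold.of_le (n := ∞) (by simp)
  rw [continuous_iff_continuousAt]
  intro p
  set T := localDomain I J F p (F p)
  set f := localRep I J F p (F p)
  have hfc := contDiffOn_localRep hF p (F p)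
  have hmaps : MapsTo f T (extChartAt J (F p)).target := fun y hy =>
    (extChartAt J (F p)).map_source hy.2
  have h1 : ContinuousOn (fun y => |(fderivWithin ℝ f T y).det| * ν.density (F p) (f y) /
      μ.density p y) T := by
    refine ContinuousOn.div (ContinuousOn.mul ?_ ?_) ((μ.continuousOn_density p).mono
      inter_subset_left) fun y hy => (μ.density_pos p hy.1).ne'
    · exact (ContinuousLinearMap.continuous_det.comp_continuousOn
        (hfc.continuousOn_fderivWithin (uniqueDiffOn_localDomain hF.continuous _ _)
          (by simp))).abs
    · exact (ν.continuousOn_density _).comp hfc.continuousOn hmaps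
  set W := (extChartAt I p).source ∩ F ⁻¹' (extChartAt J (F p)).source
  have hW : W ∈ 𝓝 p := inter_mem (extChartAt_source_mem_nhds p)
    (hF.continuous.continuousAt (extChartAt_source_mem_nhds (F p)))
  have hWT : MapsTo (extChartAt I p) W T := fun q hq =>
    ⟨(extChartAt I p).map_source hq.1, by
      simpa only [mem_preimage, (extChartAt I p).left_inv hq.1] using hq.2⟩
  have h2 := h1.comp ((continuousOn_extChartAt p).mono inter_subset_left) hWT
  refine (h2.congr fun q hq => ?_).continuousAt hW
  have := density_localRep_mul hF μ ν p (F p) (hWT hq)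
  simp only [Function.comp_apply]
  rw [this, (extChartAt I p).left_inv hq.1, mul_div_cancel_right₀ _
    (μ.density_pos p (hWT hq).1).ne']

theorem hasFDerivWithinAt_localRep {F : M → N} (hF : ContMDiff I J ∞ F) (x : M) (x' : N)
    {A : Set M} (hA' : MapsTo F A (extChartAt J x').source) :
    ∀ y ∈ (extChartAt I x).target ∩ (extChartAt I x).symm ⁻¹' A,
      HasFDerivWithinAt (localRep I J F x x')
        (fderivWithin ℝ (localRep I J F x x') (localDomain I J F x x') y)
        ((extChartAt I x).target ∩ (extChartAt I x).symm ⁻¹' A) y := fun y hy =>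
  ((contDiffOn_localRep hF x x').differentiableOn (by simp) y
    ⟨hy.1, hA' hy.2⟩).hasFDerivWithinAt.mono fun _ hz => ⟨hz.1, hA' hz.2⟩

end Local

/-! ### Chart measures and change of variables -/

theorem measurableSet_inter_preimage_of_continuousOn {X Y : Type*} [TopologicalSpace X]
    [MeasurableSpace X] [BorelSpace X] [TopologicalSpace Y] [MeasurableSpace Y] [BorelSpace Y]
    {f : X → Y} {s : Set X} (hs : MeasurableSet s) (hf : ContinuousOn f s) {A : Set Y}
    (hA : MeasurableSet A) : MeasurableSet (s ∩ f ⁻¹' A) := by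
  have h := hs.subtype_image ((continuousOn_iff_continuous_domRestrict.1 hf).measurable hA)
  convert h using 1
  ext y
  simp [and_comm]

section LocalMeasure

variable {n : ℕ} {H H' : Type*} [TopologicalSpace H] [TopologicalSpace H']
  {I : ModelWithCorners ℝ (EuclideanSpace ℝ (Fin n)) H}
  {J : ModelWithCorners ℝ (EuclideanSpace ℝ (Fin n)) H'}
  {M N : Type*} [TopologicalSpace M] [ChartedSpace H M] [TopologicalSpace N] [ChartedSpace H' N]
  [MeasurableSpace M] [BorelSpace M] [MeasurableSpace N] [BorelSpace N]

theorem measurableSet_target_inter_preimage (x : M) {A : Set M} (hA : MeasurableSet A) :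
    MeasurableSet ((extChartAt I x).target ∩ (extChartAt I x).symm ⁻¹' A) :=
  measurableSet_inter_preimage_of_continuousOn (measurableSet_extChartAt_target x)
    (continuousOn_extChartAt_symm x) hA

theorem measurableSet_source_inter_preimage (x : M) {B : Set (EuclideanSpace ℝ (Fin n))}
    (hB : MeasurableSet B) :
    MeasurableSet ((extChartAt I x).source ∩ extChartAt I x ⁻¹' B) :=
  measurableSet_inter_preimage_of_continuousOn (isOpen_extChartAt_source x).measurableSet
    (continuousOn_extChartAt x) hB

theorem measurableSet_extChartAt_source (x : M) : MeasurableSet (extChartAt I x).source :=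
  (isOpen_extChartAt_source x).measurableSet

theorem VolumeElement.setLIntegral_chartMeasure (μ : VolumeElement I M) (x : M) {A : Set M}
    (hA : MeasurableSet A) {g : M → ENNReal} (hg : Measurable g) :
    ∫⁻ p in A, g p ∂μ.chartMeasure x =
      ∫⁻ y in (extChartAt I x).target ∩ (extChartAt I x).symm ⁻¹' A,
        ENNReal.ofReal (μ.density x y) * g ((extChartAt I x).symm y) := by
  have ht := measurableSet_extChartAt_target (I := I) x
  have hm : AEMeasurable (extChartAt I x).symm
      ((volume : Measure (EuclideanSpace ℝ (Fin n))).restrict (extChartAt I x).target) :=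
    (continuousOn_extChartAt_symm x).aemeasurable ht
  have hd : AEMeasurable (fun y => ENNReal.ofReal (μ.density x y))
      ((volume : Measure (EuclideanSpace ℝ (Fin n))).restrict (extChartAt I x).target) :=
    ((μ.continuousOn_density x).aemeasurable ht).ennreal_ofReal
  have hm' := hm.mono_ac (withDensity_absolutelyContinuous _
    (fun y => ENNReal.ofReal (μ.density x y)))
  have hG : Measurable (A.indicator g) := hg.indicator hA
  rw [← lintegral_indicator hA]
  unfold chartMeasure
  change ∫⁻ p, A.indicator g p ∂(Measure.map (extChartAt I x).symm (((volume :
    Measure (EuclideanSpace ℝ (Fin n))).restrict (extChartAt I x).target).withDensity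
    (fun y => ENNReal.ofReal (μ.density x y)))) = _
  rw [lintegral_map' hG.aemeasurable hm']
  refine (lintegral_withDensity_eq_lintegral_mul₀ hd (hG.comp_aemeasurable hm)).trans ?_
  rw [← lintegral_indicator ht,
    ← lintegral_indicator (measurableSet_target_inter_preimage x hA)]
  congr 1
  ext y
  by_cases h1 : y ∈ (extChartAt I x).target <;> by_cases h2 : (extChartAt I x).symm y ∈ A <;>
    simp only [Pi.mul_apply, indicator, Function.comp_apply, mem_inter_iff, mem_preimage, h1, h2,
      and_true, and_false, if_true, if_false, mul_zero]

theorem VolumeElement.chartMeasure_apply' (μ : VolumeElement I M) (x : M) {A : Set M}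
    (hA : MeasurableSet A) :
    μ.chartMeasure x A = ∫⁻ y in (extChartAt I x).target ∩ (extChartAt I x).symm ⁻¹' A,
      ENNReal.ofReal (μ.density x y) :=
  μ.chartMeasure_apply x A hA

variable [IsManifold I ∞ M] [IsManifold J ∞ N]

theorem measurableSet_image_of_injOn {F : M → N} (hF : ContMDiff I J ∞ F) (x : M) (x' : N)
    {A : Set M} (hAm : MeasurableSet A) (hA : A ⊆ (extChartAt I x).source)
    (hA' : MapsTo F A (extChartAt J x').source) (hinj : InjOn F A) :
    MeasurableSet (F '' A) := by
  rw [eq_source_inter_preimage_image (J := J) x' hA'.image_subset,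
    chart_image_localRep (I := I) F x x' hA]
  exact measurableSet_source_inter_preimage x' (measurable_image_of_fderivWithin
    (measurableSet_target_inter_preimage x hAm) (hasFDerivWithinAt_localRep hF x x' hA')
    (injOn_localRep x x' hA' hinj))

theorem chartMeasure_image_of_injOn {F : M → N} (hF : ContMDiff I J ∞ F) (μ : VolumeElement I M)
    (ν : VolumeElement J N) (x : M) (x' : N)
    {A : Set M} (hAm : MeasurableSet A) (hA : A ⊆ (extChartAt I x).source)
    (hA' : MapsTo F A (extChartAt J x').source) (hinj : InjOn F A) :
    ν.chartMeasure x' (F '' A) =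
      ∫⁻ p in A, ENNReal.ofReal (absJac μ ν F p) ∂μ.chartMeasure x := by
  have hm := measurableSet_target_inter_preimage (I := I) x hAm
  rw [ν.chartMeasure_apply' x' (measurableSet_image_of_injOn hF x x' hAm hA hA' hinj),
    target_inter_preimage_eq_image x' hA'.image_subset, chart_image_localRep (I := I) F x x' hA,
    lintegral_image_eq_lintegral_abs_det_fderiv_mul _ hm
    (hasFDerivWithinAt_localRep hF x x' hA') (injOn_localRep x x' hA' hinj),
    μ.setLIntegral_chartMeasure x hAm (continuous_absJac hF μ ν).measurable.ennreal_ofReal]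
  refine setLIntegral_congr_fun hm fun y hy => ?_
  have := density_localRep_mul hF μ ν x x' (y := y) ⟨hy.1, hA' hy.2⟩
  rw [← ENNReal.ofReal_mul (abs_nonneg _), this, mul_comm,
    ENNReal.ofReal_mul' (absJac_nonneg _ _ _ _)]

/-- Change of variables for the identity map, whose Jacobian is 1. -/
theorem chartMeasure_eq_of_subset (μ : VolumeElement I M) (x x' : M)
    {A : Set M} (hAm : MeasurableSet A) (hA : A ⊆ (extChartAt I x).source)
    (hA' : A ⊆ (extChartAt I x').source) : μ.chartMeasure x' A = μ.chartMeasure x A := by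
  have := chartMeasure_image_of_injOn (F := id) contMDiff_id μ μ x x' hAm hA hA' (injOn_id A)
  simpa [absJac_id] using this

end LocalMeasure

/-! ### Images of critical points -/

section Sard

variable {n : ℕ} {H H' : Type*} [TopologicalSpace H] [TopologicalSpace H']
  {I : ModelWithCorners ℝ (EuclideanSpace ℝ (Fin n)) H}
  {J : ModelWithCorners ℝ (EuclideanSpace ℝ (Fin n)) H'}
  {M N : Type*} [TopologicalSpace M] [ChartedSpace H M] [TopologicalSpace N] [ChartedSpace H' N]
  [MeasurableSpace N] [BorelSpace N] [IsManifold I ∞ M] [IsManifold J ∞ N]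

/-- Sard's lemma in a pair of charts. -/
theorem exists_chartMeasure_null {F : M → N} (hF : ContMDiff I J ∞ F) (μ : VolumeElement I M)
    (ν : VolumeElement J N) (x : M) (x' : N) {A : Set M} (hA : A ⊆ (extChartAt I x).source)
    (hA' : MapsTo F A (extChartAt J x').source) (h0 : ∀ p ∈ A, absJac μ ν F p = 0) :
    ∃ B, F '' A ⊆ B ∧ MeasurableSet B ∧ B ⊆ (extChartAt J x').source ∧
      ν.chartMeasure x' B = 0 := by
  have hN : IsManifold J 1 N := IsManifold.of_le (n := ∞) (by simp)
  have hnull : volume (extChartAt J x' '' (F '' A)) = 0 := by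
    rw [chart_image_localRep (I := I) F x x' hA]
    refine addHaar_image_eq_zero_of_det_fderivWithin_eq_zero _
      (hasFDerivWithinAt_localRep hF x x' hA') fun y hy => ?_
    have := density_localRep_mul hF μ ν x x' (y := y) ⟨hy.1, hA' hy.2⟩
    rw [h0 _ hy.2, zero_mul] at this
    have hpos : 0 < ν.density x' (localRep I J F x x' y) :=
      ν.density_pos x' ((extChartAt J x').map_source (hA' hy.2))
    exact abs_eq_zero.1 ((mul_eq_zero.1 this).resolve_right hpos.ne')
  -- `A` is not assumed measurable, so its null image is enlarged to a measurable null set before it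
  -- is pulled back to `N`.
  obtain ⟨Z, hZ, hZm, hZ0⟩ := exists_measurable_superset_of_null hnull
  refine ⟨(extChartAt J x').source ∩ extChartAt J x' ⁻¹' Z,
    fun q hq => ⟨hA'.image_subset hq, hZ (mem_image_of_mem _ hq)⟩,
    measurableSet_source_inter_preimage x' hZm, inter_subset_left, ?_⟩
  rw [ν.chartMeasure_apply' x' (measurableSet_source_inter_preimage x' hZm)]
  refine setLIntegral_measure_zero _ _ (measure_mono_null (fun y hy => ?_) hZ0)
  have := hy.2.2
  rwa [mem_preimage, (extChartAt J x').right_inv hy.1] at this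

end Sard

theorem exists_seq_iUnion_eq_univ {X : Type*} [TopologicalSpace X] [SecondCountableTopology X]
    [Nonempty X] {U : X → Set X} (hU : ∀ x, U x ∈ 𝓝 x) : ∃ f : ℕ → X, ⋃ i, U (f i) = univ := by
  obtain ⟨s, hs, hsU⟩ := TopologicalSpace.countable_cover_nhds hU
  have hne : s.Nonempty := by
    by_contra h
    rw [not_nonempty_iff_eq_empty.1 h] at hsU
    simp only [mem_empty_iff_false, iUnion_of_empty, iUnion_empty] at hsU
    exact empty_ne_univ hsU
  obtain ⟨f, rfl⟩ := hs.exists_eq_range hne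
  exact ⟨f, by simpa using hsU⟩

/-! ### Borel measurability of the multiplicity -/

section Multiplicity

variable {X Y : Type*} [TopologicalSpace X] [T2Space X] [CompactSpace X]
  [SecondCountableTopology X]

/-- The number of preimages is the supremum, over finite disjoint families of closures of basic open
sets, of the number of members whose image contains the given point. -/
theorem encard_preimage_eq_iSup (f : X → Y) (q : Y) :
    ((f ⁻¹' {q}).encard : ENNReal) =
      ⨆ 𝒦 : {𝒦 : Finset (TopologicalSpace.countableBasis X) //
        (𝒦 : Set (TopologicalSpace.countableBasis X)).PairwiseDisjoint fun b => closure b.1},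
      ∑ b ∈ 𝒦.1, (f '' closure b.1).indicator (fun _ => (1 : ENNReal)) q := by
  classical
  apply le_antisymm
  · rw [← ENNReal.tsum_set_one, ENNReal.tsum_eq_iSup_sum]
    refine iSup_le fun T => ?_
    set T' : Finset X := T.map (Function.Embedding.subtype _) with hT'
    have hT'q : ∀ x ∈ T', f x = q := by
      intro x hx
      obtain ⟨y, -, rfl⟩ := Finset.mem_map.1 hx
      exact y.2
    -- Finitely many preimages are separated by disjoint open sets; regularity then yields basic
    -- neighbourhoods whose closures stay inside these.
    obtain ⟨U, hU, hUd⟩ := T'.finite_toSet.t2_separation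
    have h1 : ∀ x : X, ∃ b : TopologicalSpace.countableBasis X,
        x ∈ b.1 ∧ closure b.1 ⊆ U x := fun x => by
      obtain ⟨b, hb, hxb, hbU⟩ := (TopologicalSpace.isBasis_countableBasis X).exists_closure_subset
        ((hU x).2.mem_nhds (hU x).1)
      exact ⟨⟨b, hb⟩, hxb, hbU⟩
    choose c hxc hcU using h1
    have hcd : ∀ x ∈ T', ∀ y ∈ T', x ≠ y → Disjoint (closure (c x).1) (closure (c y).1) :=
      fun x hx y hy hxy => (hUd hx hy hxy).mono (hcU x) (hcU y)
    have hcinj : InjOn c T' := by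
      intro x hx y hy hxy
      by_contra hne
      exact disjoint_left.1 (hcd x hx y hy hne) (subset_closure (hxc x))
        (hxy ▸ subset_closure (hxc x))
    refine le_iSup_of_le ⟨T'.image c, ?_⟩ (le_of_eq ?_)
    · intro a ha b hb hab
      obtain ⟨x, hx, rfl⟩ := Finset.mem_image.1 (Finset.mem_coe.1 ha)
      obtain ⟨y, hy, rfl⟩ := Finset.mem_image.1 (Finset.mem_coe.1 hb)
      exact hcd x hx y hy fun h => hab (h ▸ rfl)
    · have hone : ∀ x ∈ T', (f '' closure (c x).1).indicator (fun _ => (1 : ENNReal)) q = 1 :=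
        fun x hx => by
          have hq : q ∈ f '' closure (c x).1 := ⟨x, subset_closure (hxc x), hT'q x hx⟩
          exact indicator_of_mem hq _
      rw [Finset.sum_image hcinj, Finset.sum_congr rfl hone]
      simp [hT']
  · refine iSup_le fun ⟨𝒦, h𝒦⟩ => ?_
    set 𝒮 := 𝒦.filter fun b => q ∈ f '' closure b.1 with h𝒮
    have h1 : ∑ b ∈ 𝒦, (f '' closure b.1).indicator (fun _ => (1 : ENNReal)) q =
        (𝒮.card : ENNReal) := by
      simp [h𝒮, indicator]
    -- One preimage from each closure that meets the fibre; disjointness makes them distinct.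
    have h2 : ∀ b : 𝒮, ∃ x, x ∈ closure b.1.1 ∧ f x = q := fun b => (Finset.mem_filter.1 b.2).2
    choose g hg hgq using h2
    have hinj : Function.Injective g := by
      intro b c hbc
      by_contra hne
      have := h𝒦 (Finset.mem_filter.1 b.2).1 (Finset.mem_filter.1 c.2).1
        (fun h => hne (Subtype.ext h))
      exact disjoint_left.1 this (hg b) (hbc ▸ hg c)
    have h3 : (range g).encard = 𝒮.card := by
      rw [← image_univ, hinj.encard_image, encard_univ]
      simp
    have h4 : (range g).encard ≤ (f ⁻¹' {q}).encard :=
      encard_le_encard (range_subset_iff.2 hgq)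
    rw [h3] at h4
    rw [h1]
    exact_mod_cast ENat.toENNReal_le.2 h4

/-- The supremum runs over a countable index set, and the images of the closures are compact, hence
closed. -/
theorem measurable_encard_preimage [TopologicalSpace Y] [T2Space Y] [MeasurableSpace Y]
    [BorelSpace Y] {f : X → Y}
    (hf : Continuous f) : Measurable fun q : Y => ((f ⁻¹' {q}).encard : ENNReal) := by
  have : Countable (TopologicalSpace.countableBasis X) :=
    (TopologicalSpace.countable_countableBasis X).to_subtype
  simp_rw [encard_preimage_eq_iSup]
  refine Measurable.iSup fun 𝒦 => Finset.measurable_sum _ fun b _ => ?_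
  exact measurable_const.indicator
    ((isClosed_closure.isCompact.image hf).isClosed.measurableSet)

end Multiplicity

/-! ### The global volume measure -/

section Global

variable {n : ℕ} {H : Type*} [TopologicalSpace H]
  {I : ModelWithCorners ℝ (EuclideanSpace ℝ (Fin n)) H}
  {M : Type*} [TopologicalSpace M] [ChartedSpace H M] [MeasurableSpace M] [BorelSpace M]

theorem VolumeElement.chartMeasure_inter_source (μ : VolumeElement I M) (x : M) {A : Set M}
    (hA : MeasurableSet A) :
    μ.chartMeasure x (A ∩ (extChartAt I x).source) = μ.chartMeasure x A := by
  rw [μ.chartMeasure_apply' x hA, μ.chartMeasure_apply' x (hA.inter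
    (measurableSet_extChartAt_source x))]
  congr 2
  ext y
  constructor
  · exact fun h => ⟨h.1, h.2.1⟩
  · exact fun h => ⟨h.1, h.2, (extChartAt I x).map_target h.1⟩

variable [IsManifold I ∞ M] [SecondCountableTopology M]

/-- The volume measure agrees with the measure of each chart on the domain of this chart. -/
theorem VolumeElement.measure_eq_chartMeasure (μ : VolumeElement I M) (x : M) {A : Set M}
    (hA : MeasurableSet A) (hAx : A ⊆ (extChartAt I x).source) :
    μ.measure A = μ.chartMeasure x A := by
  have : Nonempty M := ⟨x⟩
  obtain ⟨f, hf⟩ := exists_seq_iUnion_eq_univ fun x : M => extChartAt_source_mem_nhds (I := I) x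
  set B := disjointed fun i => (extChartAt I (f i)).source with hB
  have hBm : ∀ i, MeasurableSet (B i) := fun i =>
    MeasurableSet.disjointed (fun i => measurableSet_extChartAt_source (f i)) i
  have hBU : ⋃ i, B i = univ := by rw [hB, iUnion_disjointed, hf]
  have hBd : Pairwise (Function.onFun Disjoint B) := disjoint_disjointed _
  -- The chart measures glued along a countable partition. This measure extends all of them, so it
  -- bounds their supremum from above.
  set l : Measure M := Measure.sum fun i => (μ.chartMeasure (f i)).restrict (B i) with hl
  have hlA : ∀ (x : M) (A : Set M), MeasurableSet A → A ⊆ (extChartAt I x).source →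
      l A = μ.chartMeasure x A := by
    intro x A hA hAx
    rw [hl, Measure.sum_apply _ hA]
    have h1 : ∀ i, (μ.chartMeasure (f i)).restrict (B i) A = μ.chartMeasure x (A ∩ B i) := by
      intro i
      rw [Measure.restrict_apply hA]
      exact chartMeasure_eq_of_subset μ x (f i) (hA.inter (hBm i)) (inter_subset_left.trans hAx)
        (inter_subset_right.trans (disjointed_subset _ _))
    simp_rw [h1]
    rw [← measure_iUnion (fun i j hij => (hBd hij).mono inter_subset_right inter_subset_right)
      (fun i => hA.inter (hBm i)), ← inter_iUnion, hBU, inter_univ]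
  have hle : μ.measure ≤ l := by
    refine iSup_le fun x => Measure.le_iff.2 fun A hA => ?_
    rw [← μ.chartMeasure_inter_source x hA, ← hlA x _ (hA.inter
      (measurableSet_extChartAt_source x)) inter_subset_right]
    exact measure_mono inter_subset_left
  refine le_antisymm ((hle A).trans (hlA x A hA hAx).le) ?_
  exact (le_iSup μ.chartMeasure x) A

theorem VolumeElement.restrict_measure_eq (μ : VolumeElement I M) (x : M) {A : Set M}
    (hA : MeasurableSet A) (hAx : A ⊆ (extChartAt I x).source) :
    μ.measure.restrict A = (μ.chartMeasure x).restrict A := by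
  ext B hB
  rw [Measure.restrict_apply hB, Measure.restrict_apply hB]
  exact μ.measure_eq_chartMeasure x (hB.inter hA) (inter_subset_right.trans hAx)

/-- Near a point the density is bounded by its value there plus 1, and a coordinate ball has finite
Lebesgue measure. -/
theorem VolumeElement.isLocallyFiniteMeasure (μ : VolumeElement I M) :
    IsLocallyFiniteMeasure μ.measure := by
  refine ⟨fun p => ?_⟩
  set y := extChartAt I p p with hy
  have hyt : y ∈ (extChartAt I p).target := mem_extChartAt_target p
  have hc := (μ.continuousOn_density p y hyt).eventually (gt_mem_nhds (lt_add_one (μ.density p y)))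
  obtain ⟨V, hV, hyV, hVc⟩ := mem_nhdsWithin.1 hc
  have hO : IsOpen (V ∩ Metric.ball y 1) := hV.inter Metric.isOpen_ball
  refine ⟨(extChartAt I p).source ∩ extChartAt I p ⁻¹' (V ∩ Metric.ball y 1),
    (isOpen_extChartAt_preimage' p hO).mem_nhds
      ⟨mem_extChartAt_source p, hyV, Metric.mem_ball_self one_pos⟩, ?_⟩
  have hm := measurableSet_source_inter_preimage (I := I) p hO.measurableSet
  have hm' := measurableSet_target_inter_preimage (I := I) p hm
  have hsub : (extChartAt I p).target ∩ (extChartAt I p).symm ⁻¹' ((extChartAt I p).source ∩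
      extChartAt I p ⁻¹' (V ∩ Metric.ball y 1)) ⊆
      (V ∩ Metric.ball y 1) ∩ (extChartAt I p).target := by
    rintro z ⟨hz, -, hz'⟩
    rw [mem_preimage, (extChartAt I p).right_inv hz] at hz'
    exact ⟨hz', hz⟩
  rw [μ.measure_eq_chartMeasure p hm inter_subset_left, μ.chartMeasure_apply' p hm]
  calc _ ≤ ∫⁻ _ in (extChartAt I p).target ∩ (extChartAt I p).symm ⁻¹'
          ((extChartAt I p).source ∩ extChartAt I p ⁻¹' (V ∩ Metric.ball y 1)),
          ENNReal.ofReal (μ.density p y + 1) := by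
        refine setLIntegral_mono' hm' fun z hz => ENNReal.ofReal_le_ofReal ?_
        have hz' := hsub hz
        exact (hVc ⟨hz'.1.1, hz'.2⟩ : μ.density p z < _).le
    _ < ⊤ := by
        rw [setLIntegral_const]
        exact ENNReal.mul_lt_top ENNReal.ofReal_lt_top
          ((measure_mono (hsub.trans (inter_subset_left.trans inter_subset_right))).trans_lt
            Metric.isBounded_ball.measure_lt_top)

end Global

/-! ### The area formula -/

theorem exists_injOn_of_approximatesLinearOn {E : Type*} [NormedAddCommGroup E] [NormedSpace ℝ E]
    [FiniteDimensional ℝ E] (A : E →L[ℝ] E) : ∃ r : NNReal, r ≠ 0 ∧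
      (A.det ≠ 0 → ∀ (f : E → E) (s : Set E), ApproximatesLinearOn f A s r → InjOn f s) := by
  by_cases hA : A.det = 0
  -- A dummy radius: the partition theorem needs a nonzero one for every linear map, singular ones
  -- included.
  · exact ⟨1, one_ne_zero, fun h => (h hA).elim⟩
  set e := A.toContinuousLinearEquivOfDetNeZero hA with he
  have heA : (e : E →L[ℝ] E) = A := A.coe_toContinuousLinearEquivOfDetNeZero hA
  rcases subsingleton_or_nontrivial E with hE | hE
  · exact ⟨1, one_ne_zero, fun _ f s _ => subsingleton_of_subsingleton.injOn f⟩
  have hpos : 0 < ‖(e.symm : E →L[ℝ] E)‖₊⁻¹ := inv_pos.2 e.nnnorm_symm_pos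
  -- An error constant strictly below `‖A⁻¹‖⁻¹` forces injectivity; half of it will do.
  refine ⟨‖(e.symm : E →L[ℝ] E)‖₊⁻¹ / 2, (half_pos hpos).ne', fun _ f s hf => ?_⟩
  rw [← heA] at hf
  exact hf.injOn (Or.inr (half_lt_self hpos))

section Area

variable {n : ℕ} {H H' : Type*} [TopologicalSpace H] [TopologicalSpace H']
  {I : ModelWithCorners ℝ (EuclideanSpace ℝ (Fin n)) H}
  {J : ModelWithCorners ℝ (EuclideanSpace ℝ (Fin n)) H'}
  {M N : Type*} [TopologicalSpace M] [ChartedSpace H M] [TopologicalSpace N] [ChartedSpace H' N]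
  [MeasurableSpace M] [MeasurableSpace N]

/-- The area formula for the restriction of `F` to `A`. -/
def AreaFormulaOn (μ : VolumeElement I M) (ν : VolumeElement J N) (F : M → N) (A : Set M) : Prop :=
  AEMeasurable (fun q => Measure.count (F ⁻¹' {q} ∩ A)) ν.measure ∧
    ∫⁻ q, Measure.count (F ⁻¹' {q} ∩ A) ∂ν.measure =
      ∫⁻ p in A, ENNReal.ofReal (absJac μ ν F p) ∂μ.measure

variable {μ : VolumeElement I M} {ν : VolumeElement J N} {F : M → N}

theorem AreaFormulaOn.iUnion [BorelSpace M] [T2Space N] (hF : Continuous F) {A : ℕ → Set M}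
    (hA : ∀ i, MeasurableSet (A i)) (hd : Pairwise (Function.onFun Disjoint A))
    (h : ∀ i, AreaFormulaOn μ ν F (A i)) : AreaFormulaOn μ ν F (⋃ i, A i) := by
  have e : ∀ q, Measure.count (F ⁻¹' {q} ∩ ⋃ i, A i) =
      ∑' i, Measure.count (F ⁻¹' {q} ∩ A i) := fun q => by
    rw [inter_iUnion, measure_iUnion
      (fun i j hij => (hd hij).mono inter_subset_right inter_subset_right)
      fun i => (isClosed_singleton.preimage hF).measurableSet.inter (hA i)]
  constructor
  · simp_rw [e]
    exact AEMeasurable.tsum fun i => (h i).1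
  · simp_rw [e]
    rw [lintegral_tsum fun i => (h i).1, lintegral_iUnion hA hd]
    exact tsum_congr fun i => (h i).2

variable [BorelSpace N] [IsManifold I ∞ M] [IsManifold J ∞ N] [SecondCountableTopology N]

theorem areaFormulaOn_of_absJac_eq_zero (hF : ContMDiff I J ∞ F) (x : M) (x' : N)
    {A : Set M} (hAm : MeasurableSet A) (hA : A ⊆ (extChartAt I x).source)
    (hA' : MapsTo F A (extChartAt J x').source) (h0 : ∀ p ∈ A, absJac μ ν F p = 0) :
    AreaFormulaOn μ ν F A := by
  obtain ⟨B, hB, hBm, hBs, hB0⟩ := exists_chartMeasure_null hF μ ν x x' hA hA' h0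
  -- Fibres over points outside the null set `B` miss `A`.
  have hae : (fun q => Measure.count (F ⁻¹' {q} ∩ A)) =ᵐ[ν.measure] fun _ => 0 := by
    refine measure_mono_null (fun q hq => ?_) ((ν.measure_eq_chartMeasure x' hBm hBs).trans hB0)
    by_contra hqB
    refine hq ?_
    have : F ⁻¹' {q} ∩ A = ∅ :=
      eq_empty_of_forall_notMem fun p hp => hqB (hB ⟨p, hp.2, hp.1⟩)
    simp [this]
  refine ⟨aemeasurable_const.congr hae.symm, ?_⟩
  rw [lintegral_congr_ae hae, setLIntegral_congr_fun hAm (g := fun _ => 0)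
    fun p hp => by simp [h0 p hp]]
  simp

variable [BorelSpace M] [T2Space M] [SecondCountableTopology M]

theorem areaFormulaOn_of_injOn (hF : ContMDiff I J ∞ F) (x : M) (x' : N)
    {A : Set M} (hAm : MeasurableSet A) (hA : A ⊆ (extChartAt I x).source)
    (hA' : MapsTo F A (extChartAt J x').source) (hinj : InjOn F A) : AreaFormulaOn μ ν F A := by
  have hm := measurableSet_image_of_injOn hF x x' hAm hA hA' hinj
  have e : (fun q => Measure.count (F ⁻¹' {q} ∩ A)) =
      (F '' A).indicator (fun _ => (1 : ENNReal)) := by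
    ext q
    by_cases hq : q ∈ F '' A
    · rw [indicator_of_mem hq]
      obtain ⟨p, hp, rfl⟩ := hq
      have : F ⁻¹' {F p} ∩ A = {p} := by
        ext r
        constructor
        · exact fun h => hinj h.2 hp h.1
        · rintro rfl
          exact ⟨rfl, hp⟩
      rw [this, Measure.count_singleton]
    · rw [indicator_of_notMem hq]
      have : F ⁻¹' {q} ∩ A = ∅ := eq_empty_of_forall_notMem fun p hp => hq ⟨p, hp.2, hp.1⟩
      rw [this, measure_empty]
  rw [AreaFormulaOn, e]
  refine ⟨(measurable_const.indicator hm).aemeasurable, ?_⟩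
  rw [lintegral_indicator hm, setLIntegral_one,
    ν.measure_eq_chartMeasure x' hm hA'.image_subset, μ.restrict_measure_eq x hAm hA]
  exact chartMeasure_image_of_injOn hF μ ν x x' hAm hA hA' hinj

variable [T2Space N]

/-- A countable partition into pieces of injectivity takes the place of the inverse function
theorem, and also works at the boundary. -/
theorem areaFormulaOn_of_absJac_ne_zero (hF : ContMDiff I J ∞ F) (x : M) (x' : N)
    {A : Set M} (hAm : MeasurableSet A) (hA : A ⊆ (extChartAt I x).source)
    (hA' : MapsTo F A (extChartAt J x').source) (h0 : ∀ p ∈ A, absJac μ ν F p ≠ 0) :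
    AreaFormulaOn μ ν F A := by
  have hM : IsManifold I 1 M := IsManifold.of_le (n := ∞) (by simp)
  choose r hr hrinj using
    exists_injOn_of_approximatesLinearOn (E := EuclideanSpace ℝ (Fin n))
  obtain ⟨t, L, htd, htm, hts, htL, hL⟩ :=
    exists_partition_approximatesLinearOn_of_hasFDerivWithinAt _ _ _
      (hasFDerivWithinAt_localRep hF x x' hA') r hr
  have hAu : A = ⋃ i, A ∩ ((extChartAt I x).source ∩ extChartAt I x ⁻¹' t i) := by
    rw [← inter_iUnion, eq_comm, inter_eq_left]
    intro p hp
    have hp' : extChartAt I x p ∈ (extChartAt I x).target ∩ (extChartAt I x).symm ⁻¹' A :=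
      ⟨(extChartAt I x).map_source (hA hp), by
        rwa [mem_preimage, (extChartAt I x).left_inv (hA hp)]⟩
    obtain ⟨i, hi⟩ := mem_iUnion.1 (hts hp')
    exact mem_iUnion.2 ⟨i, hA hp, hi⟩
  rw [hAu]
  refine AreaFormulaOn.iUnion hF.continuous
    (fun i => hAm.inter (measurableSet_source_inter_preimage x (htm i)))
    (fun i j hij => ((htd hij).preimage _).mono (fun p hp => hp.2.2) (fun p hp => hp.2.2))
    fun i => areaFormulaOn_of_injOn hF x x'
      (hAm.inter (measurableSet_source_inter_preimage x (htm i)))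
      (inter_subset_left.trans hA) (hA'.mono_left inter_subset_left) ?_
  intro p hp q hq hpq
  have hmem : ∀ p ∈ A ∩ ((extChartAt I x).source ∩ extChartAt I x ⁻¹' t i), extChartAt I x p ∈
      ((extChartAt I x).target ∩ (extChartAt I x).symm ⁻¹' A) ∩ t i := fun p hp =>
    ⟨⟨(extChartAt I x).map_source (hA hp.1), by
        rw [mem_preimage, (extChartAt I x).left_inv (hA hp.1)]; exact hp.1⟩, hp.2.2⟩
  -- `L i` is the derivative at some point over `A`, hence invertible. The partition theorem asserts
  -- this only for a nonempty set; `p` supplies a point.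
  obtain ⟨y, hy, hLy⟩ := hL ⟨_, (hmem p hp).1⟩ i
  have hdet : (L i).det ≠ 0 := by
    intro hz
    have h := density_localRep_mul hF μ ν x x' (y := y) ⟨hy.1, hA' hy.2⟩
    rw [← hLy, hz, abs_zero, zero_mul] at h
    exact mul_ne_zero (h0 _ hy.2) (μ.density_pos x hy.1).ne' h.symm
  refine (extChartAt I x).injOn (hA hp.1) (hA hq.1)
    (hrinj (L i) hdet _ _ (htL i) (hmem p hp) (hmem q hq) ?_)
  simp only [localRep, Function.comp_apply, (extChartAt I x).left_inv (hA hp.1),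
    (extChartAt I x).left_inv (hA hq.1), hpq]

/-- The area formula for maps between second countable manifolds of the same dimension. -/
theorem areaFormulaOn_univ (hF : ContMDiff I J ∞ F) : AreaFormulaOn μ ν F univ := by
  rcases isEmpty_or_nonempty M with hM | hM
  · have : (univ : Set M) = ∅ := univ_eq_empty_iff.2 hM
    rw [this]
    refine ⟨by simp, by simp⟩
  have hc := hF.continuous
  -- Chart domains are shrunk so that `F` maps each into a single chart domain of `N`.
  obtain ⟨f, hf⟩ := exists_seq_iUnion_eq_univ (U := fun x : M =>
    (extChartAt I x).source ∩ F ⁻¹' (extChartAt J (F x)).source) fun x =>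
      inter_mem (extChartAt_source_mem_nhds x)
        (hc.continuousAt (extChartAt_source_mem_nhds (F x)))
  set U := fun i => (extChartAt I (f i)).source ∩ F ⁻¹' (extChartAt J (F (f i))).source with hU
  have hUm : ∀ i, MeasurableSet (disjointed U i) := fun i => MeasurableSet.disjointed (fun i =>
    ((isOpen_extChartAt_source _).inter
      ((isOpen_extChartAt_source _).preimage hc)).measurableSet) i
  have hsub : ∀ i, disjointed U i ⊆ U i := disjointed_subset U
  have hZ : MeasurableSet {p | absJac μ ν F p = 0} :=
    (continuous_absJac hF μ ν).measurable (measurableSet_singleton 0)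
  rw [← hf, ← iUnion_disjointed (f := U)]
  refine AreaFormulaOn.iUnion hc hUm (disjoint_disjointed U) fun i => ?_
  have h1 : AreaFormulaOn μ ν F (disjointed U i ∩ {p | absJac μ ν F p = 0}) :=
    areaFormulaOn_of_absJac_eq_zero hF (f i) (F (f i)) ((hUm i).inter hZ)
      (fun p hp => (hsub i hp.1).1) (fun p hp => (hsub i hp.1).2) fun p hp => hp.2
  have h2 : AreaFormulaOn μ ν F (disjointed U i \ {p | absJac μ ν F p = 0}) :=
    areaFormulaOn_of_absJac_ne_zero hF (f i) (F (f i)) ((hUm i).diff hZ)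
      (fun p hp => (hsub i hp.1).1) (fun p hp => (hsub i hp.1).2) fun p hp => hp.2
  have e : ∀ q, Measure.count (F ⁻¹' {q} ∩ disjointed U i) =
      Measure.count (F ⁻¹' {q} ∩ (disjointed U i ∩ {p | absJac μ ν F p = 0})) +
      Measure.count (F ⁻¹' {q} ∩ (disjointed U i \ {p | absJac μ ν F p = 0})) := fun q => by
    rw [← measure_inter_add_sdiff (F ⁻¹' {q} ∩ disjointed U i) hZ, inter_assoc, inter_sdiff_assoc]
  refine ⟨?_, ?_⟩
  · simp_rw [e]
    exact h1.1.add h2.1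
  · simp_rw [e]
    rw [lintegral_add_left' h1.1, h1.2, h2.2, lintegral_inter_add_sdiff _ _ hZ]

end Area

end MeasuredManifold

/-! ### The compact case -/

theorem mainTheorem5 {n : ℕ} {H H' : Type*} [TopologicalSpace H] [TopologicalSpace H']
    (I : ModelWithCorners ℝ (EuclideanSpace ℝ (Fin n)) H)
    (J : ModelWithCorners ℝ (EuclideanSpace ℝ (Fin n)) H')
    {M : Type*} [TopologicalSpace M] [ChartedSpace H M] [IsManifold I ∞ M]
    [T2Space M] [CompactSpace M] [MeasurableSpace M] [BorelSpace M]
    {N : Type*} [TopologicalSpace N] [ChartedSpace H' N] [IsManifold J ∞ N]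
    [T2Space N] [SecondCountableTopology N] [MeasurableSpace N] [BorelSpace N]
    (μ : MeasuredManifold.VolumeElement I M) (ν : MeasuredManifold.VolumeElement J N)
    (F : M → N) (hF : ContMDiff I J ∞ F) :
    Measurable (fun p : N => ((F ⁻¹' {p}).encard : ENNReal)) ∧
    Integrable (MeasuredManifold.absJac μ ν F) μ.measure ∧
    ∫⁻ p, ((F ⁻¹' {p}).encard : ENNReal) ∂ν.measure =
      ENNReal.ofReal (∫ x, MeasuredManifold.absJac μ ν F x ∂μ.measure) := by
  -- Second countability of `M` comes from compactness and from the model space, which embeds in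
  -- `ℝⁿ`.
  have hH : SecondCountableTopology H := I.secondCountableTopology
  have hM : SecondCountableTopology M := ChartedSpace.secondCountable_of_sigmaCompact H M
  have hfin := μ.isLocallyFiniteMeasure
  have hint : Integrable (MeasuredManifold.absJac μ ν F) μ.measure :=
    integrableOn_univ.1
      ((MeasuredManifold.continuous_absJac hF μ ν).continuousOn.integrableOn_compact isCompact_univ)
  refine ⟨MeasuredManifold.measurable_encard_preimage hF.continuous, hint, ?_⟩
  rw [ofReal_integral_eq_lintegral_ofReal hint
    (Filter.Eventually.of_forall (MeasuredManifold.absJac_nonneg μ ν F))]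
  have h := (MeasuredManifold.areaFormulaOn_univ (μ := μ) (ν := ν) hF).2
  rw [Measure.restrict_univ] at h
  rw [← h]
  refine lintegral_congr fun q => ?_
  rw [Set.inter_univ, Measure.count_apply (isClosed_singleton.preimage hF.continuous).measurableSet]
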